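/- A half-edge ribbon graph (HERG) $G_H$ consists of a finite ribbon graph $G$ (vertex discs $V$ and edge ribbons $E$ glued along disjoint boundary segments; orientable or not, connected or not) together with a finite set $H$ of half-ribbons, each a rectangle glued along one of its sides to the boundary of one vertex disc, disjointly from all the other gluing segments; the side opposite to the glued one is its external segment. For $A\subseteq E$, consider the spanning subgraph with vertex discs $V$, edge ribbons $A$ and all half-ribbons $H$. Let $k(A)$ be its number of connected components, $r(A)=|V|-k(A)$, $n(A)=|A|-r(A)$, $C_{\rm ext}(A)$ the number of its boundary components that contain the external segment of some half-ribbon (external cycles), $f_{\rm int}(A)$ the number of its other boundary components (closed faces), and $o(A)=0$ if it is orientable as a surface, $o(A)=1$ otherwise. Put $$R_{G_H}(x,y,z,s,w,t)=\sum_{A\subseteq E}(x-1)^{r(G_H)-r(A)}\,y^{n(A)}\,z^{k(A)-f_{\rm int}(A)+n(A)}\,s^{C_{\rm ext}(A)}\,w^{o(A)}\,t^{|H|},\qquad r(G_H)=r(E).$$ The geometric dual $G_H^*$ is the HERG obtained as follows. Turn each half-ribbon $h$ into an edge that ends at a new leaf $v_h$, cap off the resulting ribbon graph to a closed surface, and pierce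 the surface at each leaf, so that each $v_h$ lies on its own boundary circle $c_h$. Take the geometric dual of this embedded graph; the dual of the edge ending at $v_h$ is a loop that encircles $c_h$. Replace each of these loops by an edge from its vertex to a new leaf on $c_h$, at the same place in the cyclic order around the vertex; then delete the new leaves, so that these edges become half-edges, and let $G_H^*$ be a ribbon neighbourhood of the resulting embedded half-edge graph. **Theorem.** For every HERG $G_H$, every field $K$, and all $a,b\in K$ with $a\neq 0$, $$R_{G_H}(a+1,a,a^{-1},b,1,1)=R_{G_H^*}(a+1,a,a^{-1},b,1,1).$$ In particular the identity holds in $\mathbb Z[a,a^{-1},b]$. -/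

import Mathlib

open Sum

/-- The line segments along which ribbons are glued to vertex discs: an edge ribbon `e` has two ends
`(e, false)`, `(e, true)`, a half-ribbon `h` has one. -/
abbrev Seg (E H : Type*) := (E × Bool) ⊕ H

/-- The end-points of the gluing segments, two on each.  The ribbon `e` is a rectangle whose corner
`(inl (e, i), j)` lies on the end `i` and on the long side `j`; the corners of a half-ribbon `h` that
lie on its vertex disc are `(inr h, false)` and `(inr h, true)`. -/
abbrev Corner (E H : Type*) := Seg E H × Bool

/-- One step along the boundary circle of a vertex disc: either along a gluing segment,
or along an arc between two consecutive gluing segments. -/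
inductive DiscStep {E H : Type*} (arc : Corner E H → Corner E H) : Corner E H → Corner E H → Prop
  | seg (s : Seg E H) (j : Bool) : DiscStep arc (s, j) (s, !j)
  | arc (p : Corner E H) : DiscStep arc p (arc p)

/-- A half-edge ribbon graph (HERG) with vertex discs `V`, edge ribbons `E` and half-ribbons `H`,
given by its gluing data, not necessarily orientable or connected.
`inc s` is the vertex disc on whose boundary the segment `s` lies.  The segments are disjoint, and
the rest of the boundary of the discs consists of arcs between end-points of segments (and of
the whole boundary circle of a disc with no segment): `arc p` is the other end of the arc that
starts at `p`.  By `circle`, the segments and arcs at a vertex form a single closed curve. -/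
structure HERG (V E H : Type*) where
  inc : Seg E H → V
  arc : Corner E H → Corner E H
  arc_arc : ∀ p, arc (arc p) = p
  arc_ne : ∀ p, arc p ≠ p
  inc_arc : ∀ p, inc (arc p).1 = inc p.1
  circle : ∀ p q, inc p.1 = inc q.1 → Relation.EqvGen (DiscStep arc) p q

/-- A ribbon graph is a HERG without half-ribbons. -/
abbrev RibbonGraph (V E : Type*) := HERG V E Empty

namespace HERG

section Invariants

variable {V E H : Type*} (G : HERG V E H)

/-- Marked points on the boundary of the surface: the corners and, for each vertex disc to
which no ribbon or half-ribbon is glued, one point on its boundary circle. -/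
abbrev BdPoint := Corner E H ⊕ {v : V // ∀ s, G.inc s ≠ v}

/-- One step along the boundary of the spanning subgraph with edge set `A` (all the vertex
discs, the edge ribbons in `A`, all the half-ribbons), regarded as a surface with boundary. -/
inductive BdStep (A : Set E) : G.BdPoint → G.BdPoint → Prop
  /-- along the boundary of a vertex disc, between two consecutive gluing segments -/
  | arc (p : Corner E H) : BdStep A (inl p) (inl (G.arc p))
  /-- along a long side of a ribbon that is present -/
  | side (e : E) (he : e ∈ A) (i j : Bool) :
      BdStep A (inl (inl (e, i), j)) (inl (inl (e, !i), j))
  /-- along the segment to which an absent ribbon was glued, now a part of the boundary -/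
  | gap (e : E) (he : e ∉ A) (i j : Bool) :
      BdStep A (inl (inl (e, i), j)) (inl (inl (e, i), !j))
  /-- around a half-ribbon: a side, the external segment, the other side -/
  | halfRibbon (h : H) (j : Bool) : BdStep A (inl (inr h, j)) (inl (inr h, !j))

/-- The boundary components of the spanning subgraph with edge set `A`. -/
def BdComp (A : Set E) := Quot (G.BdStep A)

/-- An external cycle is a boundary component that runs along the external segment of some
half-ribbon. -/
def IsExternal (A : Set E) (c : G.BdComp A) : Prop :=
  ∃ (h : H) (j : Bool), c = Quot.mk _ (inl (inr h, j))

/-- `f_int(A)`: the number of closed faces, the boundary components that meet no external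
segment. -/
noncomputable def fInt (A : Set E) : ℕ := Nat.card {c : G.BdComp A // ¬ G.IsExternal A c}

/-- `C_ext(A)`: the number of external cycles. -/
noncomputable def cExt (A : Set E) : ℕ := Nat.card {c : G.BdComp A // G.IsExternal A c}

/-- `k(A)`: the number of connected components of the spanning subgraph with edge set `A`. -/
noncomputable def comps (A : Set E) : ℕ :=
  Nat.card (Quot fun u v : V => ∃ e ∈ A, u = G.inc (inl (e, false)) ∧ v = G.inc (inl (e, true)))

/-- `r(A) = |V| - k(A)`. -/
noncomputable def rank (A : Set E) : ℤ := (Nat.card V : ℤ) - G.comps A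

/-- `n(A) = |A| - r(A)`. -/
noncomputable def nullity (A : Set E) : ℤ := (A.ncard : ℤ) - G.rank A

/-- The spanning subgraph with edge set `A` is an orientable surface.  An orientation of the discs
`V` tells for each gluing segment which end-point comes first along the oriented
boundary circle of its disc (`c = true`); these end-points alternate with the others along each
circle.  It extends over a ribbon exactly if each long side joins end-points of different kinds. -/
def Orientable (A : Set E) : Prop :=
  ∃ c : Corner E H → Bool,
    (∀ s j, c (s, !j) = !c (s, j)) ∧ (∀ p, c (G.arc p) = !c p) ∧
      ∀ e ∈ A, ∀ i j, c (inl (e, !i), j) = !c (inl (e, i), j)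

open Classical in
/-- `o(A)`: 0 if the spanning subgraph with edge set `A` is orientable, 1 otherwise. -/
noncomputable def nonOr (A : Set E) : ℕ := if G.Orientable A then 0 else 1

/-- The polynomial of the first kind,
`R_G(x, y, z, s, w, t) = ∑_A (x-1)^(r(G)-r(A)) y^n(A) z^(k(A)-f_int(A)+n(A)) s^C_ext(A) w^o(A) t^|H|`,
the sum over all spanning subgraphs, i.e. over all subsets `A` of the edge set. -/
noncomputable def brPoly [Fintype E] {K : Type*} [Field K] (x y z s w t : K) : K :=
  ∑ A : Finset E,
    (x - 1) ^ (G.rank Set.univ - G.rank (A : Set E)) * y ^ G.nullity (A : Set E) *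
      z ^ ((G.comps (A : Set E) : ℤ) - G.fInt (A : Set E) + G.nullity (A : Set E)) *
      s ^ G.cExt (A : Set E) * w ^ G.nonOr (A : Set E) * t ^ Nat.card H

end Invariants

section RibbonDual

variable {V E : Type*}

/-- The corner `(i, j)` of the ribbon `e` is the corner `(j, i)` of the dual ribbon, which crosses
`e` transversally and is glued along the two long sides of `e`. -/
def turn : Corner E Empty → Corner E Empty
  | (inl (e, i), j) => (inl (e, j), i)

theorem turn_turn (p : Corner E Empty) : turn (turn p) = p := by
  obtain ⟨⟨e, i⟩ | h, j⟩ := p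
  · rfl
  · exact h.elim

/-- The face along which a segment of the dual ribbon graph runs. -/
def faceOf (G : RibbonGraph V E) : Seg E Empty → G.BdComp Set.univ
  | inl (e, j) => Quot.mk _ (inl (inl (e, false), j))

theorem faceOf_turn (G : RibbonGraph V E) (p : Corner E Empty) :
    faceOf G (turn p).1 = Quot.mk _ (inl p) := by
  obtain ⟨⟨e, i⟩ | h, j⟩ := p
  · cases i
    · rfl
    · exact Quot.sound (BdStep.side e (Set.mem_univ _) false j)
  · exact h.elim

/-- The geometric dual of the cellular embedding given by a ribbon graph (in the closed surface
obtained by capping off): one vertex in each face, and for each edge `e` a dual edge that crosses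
`e` and joins the faces on both sides of it. -/
def ribbonDual (G : RibbonGraph V E) : RibbonGraph (G.BdComp Set.univ) E where
  inc := faceOf G
  arc p := turn (G.arc (turn p))
  arc_arc p := by rw [turn_turn, G.arc_arc, turn_turn]
  arc_ne p h := G.arc_ne (turn p) (by rw [← turn_turn (G.arc (turn p)), h])
  inc_arc p := by
    rw [faceOf_turn, ← turn_turn p, faceOf_turn, turn_turn]
    exact (Quot.sound (BdStep.arc _)).symm
  circle p q hpq := by
    rw [← turn_turn p, ← turn_turn q, faceOf_turn, faceOf_turn] at hpq
    have key : ∀ x y : G.BdPoint, Relation.EqvGen (G.BdStep Set.univ) x y →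
        (∃ a b, x = inl a ∧ y = inl b ∧
          Relation.EqvGen (DiscStep fun p => turn (G.arc (turn p))) (turn a) (turn b)) ∨
        (∃ v, x = inr v ∧ y = inr v) := by
      intro x y hxy
      induction hxy with
      | rel x y h =>
        left
        cases h with
        | arc p =>
          refine ⟨_, _, rfl, rfl, .rel _ _ ?_⟩
          have := DiscStep.arc (arc := fun p => turn (G.arc (turn p))) (turn p)
          simpa only [turn_turn] using this
        | side e he i j => exact ⟨_, _, rfl, rfl, .rel _ _ (DiscStep.seg (inl (e, j)) i)⟩
        | gap e he i j => exact absurd (Set.mem_univ e) he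
        | halfRibbon h j => exact h.elim
      | refl x =>
        cases x with
        | inl a => exact Or.inl ⟨a, a, rfl, rfl, .refl _⟩
        | inr v => exact Or.inr ⟨v, rfl, rfl⟩
      | symm x y _ ih =>
        rcases ih with ⟨a, b, rfl, rfl, h⟩ | ⟨v, rfl, rfl⟩
        · exact Or.inl ⟨b, a, rfl, rfl, .symm _ _ h⟩
        · exact Or.inr ⟨v, rfl, rfl⟩
      | trans x y z _ _ ih1 ih2 =>
        rcases ih1 with ⟨a, b, rfl, rfl, h⟩ | ⟨v, rfl, rfl⟩
        · rcases ih2 with ⟨a', b', h1, rfl, h'⟩ | ⟨v, h1, _⟩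
          · cases h1
            exact Or.inl ⟨_, _, rfl, rfl, .trans _ _ _ h h'⟩
          · cases h1
        · rcases ih2 with ⟨a', b', h1, _, _⟩ | ⟨v', h1, rfl⟩
          · cases h1
          · exact Or.inr ⟨v, rfl, h1.symm⟩
    rcases key _ _ (Quot.eqvGen_exact hpq) with ⟨a, b, h1, h2, h⟩ | ⟨v, h1, _⟩
    · cases h1
      cases h2
      simpa only [turn_turn] using h
    · cases h1

end RibbonDual

end HERG

/-- An `h`-proper cellular embedding in a punctured surface of a half-edge graph with vertices `V`,
edges `E` and half-edges `H`, up to equivalence: the ribbon graph of the regular embedding of its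
completed graph.  The edge `inr h` completes the half-edge `h`, and its end `true` lies at the leaf
`inr h`, which is the only vertex on its own boundary circle of the punctured surface.  The surface
is obtained by capping off the ribbon graph and piercing it at the leaves. -/
structure HProperEmbedding (V E H : Type*) where
  graph : RibbonGraph (V ⊕ H) (E ⊕ H)
  leaf : ∀ s h, graph.inc s = inr h ↔ s = inl (inr h, true)

namespace HERG

section Complete

variable {V E H : Type*} (G : HERG V E H)

/-- The corners of a HERG as corners of its completed ribbon graph. -/
def emb : Corner E H → Corner (E ⊕ H) Empty
  | (inl (e, i), j) => (inl (inl e, i), j)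
  | (inr h, j) => (inl (inr h, false), j)

/-- The vertices of the completed ribbon graph: the old ones and one leaf for each half-ribbon. -/
def complInc : Seg (E ⊕ H) Empty → V ⊕ H
  | inl (inl e, i) => inl (G.inc (inl (e, i)))
  | inl (inr h, false) => inl (G.inc (inr h))
  | inl (inr h, true) => inr h

/-- The boundary arcs of the vertex discs of the completed ribbon graph. -/
def complArc : Corner (E ⊕ H) Empty → Corner (E ⊕ H) Empty
  | (inl (inl e, i), j) => emb (G.arc (inl (e, i), j))
  | (inl (inr h, false), j) => emb (G.arc (inr h, j))
  | (inl (inr h, true), j) => (inl (inr h, true), !j)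

theorem complArc_emb (p : Corner E H) : G.complArc (emb p) = emb (G.arc p) := by
  obtain ⟨⟨e, i⟩ | h, j⟩ := p <;> rfl

theorem complInc_emb (p : Corner E H) : G.complInc (emb p).1 = inl (G.inc p.1) := by
  obtain ⟨⟨e, i⟩ | h, j⟩ := p <;> rfl

theorem emb_injective : Function.Injective (emb (E := E) (H := H)) := by
  rintro ⟨⟨e, i⟩ | h, j⟩ ⟨⟨e', i'⟩ | h', j'⟩ hh <;> simp_all [emb]

theorem emb_or_leaf (p : Corner (E ⊕ H) Empty) :
    (∃ q, p = emb q) ∨ ∃ h j, p = (inl (inr h, true), j) := by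
  obtain ⟨⟨e | h, i⟩ | h, j⟩ := p
  · exact Or.inl ⟨(inl (e, i), j), rfl⟩
  · cases i
    · exact Or.inl ⟨(inr h, j), rfl⟩
    · exact Or.inr ⟨h, j, rfl⟩
  · exact h.elim

theorem eqvGen_map {α β : Type*} {r : α → α → Prop} {r' : β → β → Prop} (f : α → β)
    (hf : ∀ a b, r a b → Relation.EqvGen r' (f a) (f b)) {a b : α} (h : Relation.EqvGen r a b) :
    Relation.EqvGen r' (f a) (f b) := by
  induction h with
  | rel a b h => exact hf a b h
  | refl a => exact .refl _
  | symm a b _ ih => exact .symm _ _ ih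
  | trans a b c _ _ ih1 ih2 => exact .trans _ _ _ ih1 ih2

theorem eqvGen_bool {α : Type*} {r : α → α → Prop} (f : Bool → α) (hf : ∀ j, r (f j) (f !j))
    (j j' : Bool) : Relation.EqvGen r (f j) (f j') := by
  by_cases h : j' = j
  · rw [h]; exact .refl _
  · have : j' = !j := by cases j <;> cases j' <;> simp_all
    rw [this]; exact .rel _ _ (hf j)

/-- The completed ribbon graph: each half-ribbon becomes an edge ribbon that ends at a new leaf. -/
def completed : RibbonGraph (V ⊕ H) (E ⊕ H) where
  inc := G.complInc
  arc := G.complArc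
  arc_arc p := by
    rcases emb_or_leaf p with ⟨q, rfl⟩ | ⟨h, j, rfl⟩
    · rw [complArc_emb, complArc_emb, G.arc_arc]
    · simp [complArc]
  arc_ne p := by
    rcases emb_or_leaf p with ⟨q, rfl⟩ | ⟨h, j, rfl⟩
    · rw [complArc_emb]
      exact fun h => G.arc_ne q (emb_injective h)
    · simp [complArc]
  inc_arc p := by
    rcases emb_or_leaf p with ⟨q, rfl⟩ | ⟨h, j, rfl⟩
    · rw [complArc_emb, complInc_emb, complInc_emb, G.inc_arc]
    · simp [complArc]
  circle p q hpq := by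
    rcases emb_or_leaf p with ⟨p, rfl⟩ | ⟨h, j, rfl⟩ <;>
      rcases emb_or_leaf q with ⟨q, rfl⟩ | ⟨h', j', rfl⟩
    · rw [complInc_emb, complInc_emb] at hpq
      refine eqvGen_map emb ?_ (G.circle p q (inl_injective hpq))
      rintro c _ (⟨s, j⟩ | ⟨⟩)
      · refine .rel _ _ ?_
        obtain ⟨e, i⟩ | h := s
        · exact DiscStep.seg (inl (inl e, i)) j
        · exact DiscStep.seg (inl (inr h, false)) j
      · refine .rel _ _ ?_
        rw [← complArc_emb]
        exact DiscStep.arc _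
    · rw [complInc_emb] at hpq
      simp [complInc] at hpq
    · rw [complInc_emb] at hpq
      simp [complInc] at hpq
    · have : h = h' := by simpa [complInc] using hpq
      subst this
      exact eqvGen_bool (fun j => ((inl (inr h, true), j) : Corner (E ⊕ H) Empty))
        (fun j => DiscStep.seg _ j) j j'

/-- The `h`-proper cellular embedding to which a HERG corresponds. -/
def toEmbedding : HProperEmbedding V E H where
  graph := G.completed
  leaf s h := by
    obtain ⟨e | h', i⟩ | h' := s
    · simp [completed, complInc]
    · cases i <;> simp [completed, complInc]
    · exact h'.elim

end Complete

end HERG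

namespace HProperEmbedding

open HERG

variable {V E H : Type*}

theorem arc_leaf (M : HProperEmbedding V E H) (h : H) (j : Bool) :
    M.graph.arc (inl (inr h, true), j) = (inl (inr h, true), !j) := by
  have h1 := M.graph.inc_arc (inl (inr h, true), j)
  rw [(M.leaf (inl (inr h, true)) h).2 rfl, M.leaf] at h1
  have h2 := M.graph.arc_ne (inl (inr h, true), j)
  refine Prod.ext h1 ?_
  by_contra h3
  refine h2 (Prod.ext h1 ?_)
  cases j <;> simpa using h3

section Prune

variable (M : HProperEmbedding V E H)

/-- The retraction of the corners of the completed graph to those of the pruned one. -/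
def unemb : Corner (E ⊕ H) Empty → Corner E H
  | (inl (inl e, i), j) => (inl (e, i), j)
  | (inl (inr h, _), j) => (inr h, j)

theorem unemb_emb (p : Corner E H) : unemb (emb p) = p := by
  obtain ⟨⟨e, i⟩ | h, j⟩ := p <;> rfl

theorem emb_unemb (p : Corner (E ⊕ H) Empty) (hp : ∀ h, p.1 ≠ inl (inr h, true)) :
    emb (unemb p) = p := by
  rcases emb_or_leaf p with ⟨q, rfl⟩ | ⟨h, j, rfl⟩
  · rw [unemb_emb]
  · exact absurd rfl (hp h)

theorem emb_ne_leaf (p : Corner E H) (h : H) : (emb p).1 ≠ inl (inr h, true) := by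
  obtain ⟨⟨e, i⟩ | h, j⟩ := p <;> simp [emb]

theorem isLeft_inc (p : Corner E H) : (M.graph.inc (emb p).1).isLeft := by
  cases hv : M.graph.inc (emb p).1 with
  | inl v => rfl
  | inr h => exact absurd ((M.leaf _ h).1 hv) (emb_ne_leaf p h)

theorem emb_unemb_arc (p : Corner E H) :
    emb (unemb (M.graph.arc (emb p))) = M.graph.arc (emb p) := by
  refine emb_unemb _ fun h hh => ?_
  have h1 := M.graph.inc_arc (emb p)
  rw [hh, (M.leaf (inl (inr h, true)) h).2 rfl] at h1
  exact emb_ne_leaf p h ((M.leaf _ h).1 h1.symm)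

theorem eqvGen_disc (M : HProperEmbedding V E H) {p q : Corner (E ⊕ H) Empty}
    (h : Relation.EqvGen (DiscStep M.graph.arc) p q) : M.graph.inc p.1 = M.graph.inc q.1 := by
  induction h with
  | rel p q h =>
    cases h with
    | seg s j => rfl
    | arc p => exact (M.graph.inc_arc p).symm
  | refl p => rfl
  | symm p q _ ih => exact ih.symm
  | trans p q r _ _ ih1 ih2 => exact ih1.trans ih2

/-- The HERG of an `h`-proper embedding, a small neighbourhood of the embedded half-edge graph:
the leaves are pruned, so that the edges which end at them become half-ribbons. -/
def toHERG : HERG V E H where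
  inc s := (M.graph.inc (emb (s, false)).1).getLeft (M.isLeft_inc (s, false))
  arc p := unemb (M.graph.arc (emb p))
  arc_arc p := by rw [M.emb_unemb_arc, M.graph.arc_arc, unemb_emb]
  arc_ne p h := M.graph.arc_ne (emb p) (by rw [← M.emb_unemb_arc, h])
  inc_arc p := by
    apply inl_injective (β := H)
    rw [inl_getLeft, inl_getLeft]
    have e1 : ∀ q : Corner E H, (emb (q.1, false)).1 = (emb q).1 := by
      rintro ⟨⟨e, i⟩ | h, j⟩ <;> rfl
    rw [e1, e1, M.emb_unemb_arc, M.graph.inc_arc]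
  circle p q hpq := by
    have e1 : ∀ q : Corner E H, (emb (q.1, false)).1 = (emb q).1 := by
      rintro ⟨⟨e, i⟩ | h, j⟩ <;> rfl
    have hpq := congrArg (inl (β := H)) hpq
    rw [inl_getLeft, inl_getLeft, e1, e1] at hpq
    have := eqvGen_map (r' := DiscStep fun p => unemb (M.graph.arc (emb p))) unemb ?_
      (M.graph.circle _ _ hpq)
    · simpa only [unemb_emb] using this
    rintro c _ (⟨s, j⟩ | ⟨⟩)
    · refine .rel _ _ ?_
      obtain ⟨e | h, i⟩ | h := s
      · exact DiscStep.seg (inl (e, i)) j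
      · exact DiscStep.seg (inr h) j
      · exact h.elim
    · refine .rel _ _ ?_
      rcases emb_or_leaf c with ⟨q, rfl⟩ | ⟨h, j, rfl⟩
      · rw [unemb_emb]
        exact DiscStep.arc q
      · rw [M.arc_leaf]
        exact DiscStep.seg (inr h) j

end Prune

section Graft

variable (D : RibbonGraph V (E ⊕ H))

/-- `D` has for each `h : H` a loop whose ends are consecutive at their vertex: the arc between them
joins the corners on the side `true` of the ribbon, so that this side of the loop bounds a face
with no other edge on it (a face which contains a boundary circle of the punctured surface). -/
def Encircles : Prop := ∀ h : H, D.arc (inl (inr h, false), true) = (inl (inr h, true), true)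

/-- Corners of the grafted graph as corners of the graph before grafting.  The end `false` of the
edge inserted in place of the loop `h` runs between the two outer corners of the loop, its end `true`
between the two inner ones, the corners of the arc inside the loop. -/
def graftCorner : Corner (E ⊕ H) Empty → Corner (E ⊕ H) Empty
  | (inl (inl e, i), j) => (inl (inl e, i), j)
  | (inl (inr h, i), j) => (inl (inr h, j), i)

theorem graftCorner_graftCorner (p : Corner (E ⊕ H) Empty) :
    graftCorner (graftCorner p) = p := by
  obtain ⟨⟨e | h, i⟩ | h, j⟩ := p
  · rfl
  · rfl
  · exact h.elim

/-- The incidence relation of the grafted graph: the edge inserted in place of the loop `h`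
joins the vertex of the loop to a new vertex, placed on the boundary circle inside the loop. -/
def graftInc : Seg (E ⊕ H) Empty → V ⊕ H
  | inl (inl e, i) => inl (D.inc (inl (inl e, i)))
  | inl (inr h, false) => inl (D.inc (inl (inr h, false)))
  | inl (inr h, true) => inr h

/-- The arc inside a loop becomes the boundary of the new leaf, all other arcs remain. -/
def graftArc (p : Corner (E ⊕ H) Empty) : Corner (E ⊕ H) Empty :=
  graftCorner (D.arc (graftCorner p))

variable {D}

theorem Encircles.graftArc_leaf (hD : Encircles D) (h : H) (j : Bool) :
    graftArc D (inl (inr h, true), j) = (inl (inr h, true), !j) := by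
  cases j
  · simp [graftArc, graftCorner, hD h]
  · have := hD h
    have h2 := D.arc_arc (inl (inr h, false), true)
    rw [this] at h2
    simp [graftArc, graftCorner, h2]

theorem graftArc_graftArc (p : Corner (E ⊕ H) Empty) : graftArc D (graftArc D p) = p := by
  simp only [graftArc, graftCorner_graftCorner, D.arc_arc]

theorem Encircles.inc_loop (hD : Encircles D) (h : H) (i : Bool) :
    D.inc (inl (inr h, i)) = D.inc (inl (inr h, false)) := by
  cases i
  · rfl
  · have := D.inc_arc (inl (inr h, false), true)
    rwa [hD h] at this

theorem Encircles.graftInc_of_emb (hD : Encircles D) (p : Corner E H) :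
    graftInc D (emb p).1 = inl (D.inc (graftCorner (emb p)).1) := by
  obtain ⟨⟨e, i⟩ | h, j⟩ := p
  · rfl
  · simp [graftInc, emb, graftCorner, hD.inc_loop h j]

theorem Encircles.graftArc_emb (hD : Encircles D) (p : Corner E H) :
    ∃ q, graftArc D (emb p) = emb q := by
  rcases emb_or_leaf (graftArc D (emb p)) with h | ⟨h, j, hh⟩
  · exact h
  · have h1 := congrArg (graftArc D) hh
    rw [graftArc_graftArc, hD.graftArc_leaf] at h1
    exact absurd (congrArg Prod.fst h1) (emb_ne_leaf p h)

/-- Grafting: each of the loops `inr h` is replaced by an edge from its vertex to a new vertex on the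
boundary circle that it encircles, at the same place in the cyclic order. -/
def graft (hD : Encircles D) : HProperEmbedding V E H where
  graph :=
    { inc := graftInc D
      arc := graftArc D
      arc_arc := graftArc_graftArc
      arc_ne := fun p hp => D.arc_ne (graftCorner p) (by
        rw [← graftCorner_graftCorner (D.arc _)]
        exact congrArg graftCorner hp)
      inc_arc := fun p => by
        rcases emb_or_leaf p with ⟨q, rfl⟩ | ⟨h, j, rfl⟩
        · obtain ⟨q', hq'⟩ := hD.graftArc_emb q
          rw [hq', hD.graftInc_of_emb, hD.graftInc_of_emb, ← hq', graftArc,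
            graftCorner_graftCorner, D.inc_arc]
        · rw [hD.graftArc_leaf]
      circle := fun p q hpq => by
        have key : ∀ a b, Relation.EqvGen (DiscStep D.arc) a b →
            Relation.EqvGen (DiscStep (graftArc D)) (emb (unemb (graftCorner a)))
              (emb (unemb (graftCorner b))) := by
          intro a b hab
          refine eqvGen_map (fun a => emb (unemb (graftCorner a))) ?_ hab
          rintro c _ (⟨s, j⟩ | ⟨⟩)
          · obtain ⟨e | h, i⟩ | h := s
            · exact .rel _ _ (DiscStep.seg (inl (inl e, i)) j)
            · exact .refl _
            · exact h.elim
          · obtain ⟨p, rfl⟩ : ∃ p', c = graftCorner p' := ⟨_, (graftCorner_graftCorner c).symm⟩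
            change Relation.EqvGen _ (emb (unemb (graftCorner (graftCorner p))))
              (emb (unemb (graftArc D p)))
            rw [graftCorner_graftCorner]
            rcases emb_or_leaf p with ⟨q, rfl⟩ | ⟨h, j, rfl⟩
            · obtain ⟨q', hq'⟩ := hD.graftArc_emb q
              have := DiscStep.arc (arc := graftArc D) (emb q)
              rw [hq'] at this ⊢
              rw [unemb_emb, unemb_emb]
              exact .rel _ _ this
            · rw [hD.graftArc_leaf]
              exact .rel _ _ (DiscStep.seg (inl (inr h, false)) j)
        rcases emb_or_leaf p with ⟨p, rfl⟩ | ⟨h, j, rfl⟩ <;>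
          rcases emb_or_leaf q with ⟨q, rfl⟩ | ⟨h', j', rfl⟩
        · rw [hD.graftInc_of_emb, hD.graftInc_of_emb] at hpq
          have := key _ _ (D.circle _ _ (inl_injective hpq))
          simpa only [graftCorner_graftCorner, unemb_emb] using this
        · rw [hD.graftInc_of_emb] at hpq
          simp [graftInc] at hpq
        · rw [hD.graftInc_of_emb] at hpq
          simp [graftInc] at hpq
        · have : h = h' := by simpa [graftInc] using hpq
          subst this
          exact eqvGen_bool (fun j => ((inl (inr h, true), j) : Corner (E ⊕ H) Empty))
            (fun j => DiscStep.seg _ j) j j' }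
  leaf s h := by
    obtain ⟨e | h', i⟩ | h' := s
    · simp [graftInc]
    · cases i <;> simp [graftInc]
    · exact h'.elim

end Graft

theorem encircles_dual (M : HProperEmbedding V E H) : Encircles M.graph.ribbonDual := by
  intro h
  change turn (M.graph.arc (inl (inr h, true), false)) = _
  rw [M.arc_leaf]
  rfl

/-- The geometric dual of an `h`-proper embedding, in the same punctured surface: in the geometric
dual of the completed graph the duals of the edges `inr h` are loops around the boundary circles,
and these are grafted. -/
def dual (M : HProperEmbedding V E H) : HProperEmbedding (M.graph.BdComp Set.univ) E H :=
  graft M.encircles_dual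

end HProperEmbedding

/-- The geometric dual of a HERG: the HERG of the geometric dual of the `h`-proper embedding
to which it corresponds. -/
def HERG.dual {V E H : Type*} (G : HERG V E H) :
    HERG (G.toEmbedding.graph.BdComp Set.univ) E H :=
  G.toEmbedding.dual.toHERG

/-!
At `(a + 1, a, a⁻¹, b, 1, 1)` the exponents of `a` in the term of `A` add up to
`f_int(A) - k(E)`, so that the polynomial becomes `∑ A, a ^ (f_int(A) - k(E)) * b ^ C_ext(A)`
(`HERG.brPoly_eq_sum`).  It remains to compare `A` with its complement in the dual.

A HERG and its dual have the same corners, up to the involution `HERG.dualCorner` that exchanges the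
two pairs of opposite sides of each edge ribbon and fixes the corners of the half-ribbons.  This
involution carries the arcs of `G` to those of the dual, the long sides of a ribbon to the gluing
segments of the dual ribbon, and vice versa.  Hence a walk along the boundary of the subgraph `A`,
which follows the sides of the ribbons in `A` and the segments of the ribbons outside `A`,
becomes a walk along the boundary of the subgraph `Aᶜ` of the dual (`HERG.bdStep_iff_dual`), and it
meets the same half-ribbons.  The marked points on discs without segments correspond too: such a
disc of the dual lies in a face of the completed graph with no corner, that is, in the face around an
isolated vertex (`HERG.isolatedEquiv`).  Therefore `f_int` and `C_ext` of `A` and of `Aᶜ` agree.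

Finally `k(E) = k(E*)`: the connected components are the classes of marked points under the
boundary steps of the subgraphs `E` and `∅` taken together (`HERG.comps_univ_eq`), and duality
exchanges these two kinds of steps.
-/

namespace HERG

variable {V E H : Type*} (G : HERG V E H)

/-! ### The specialised polynomial -/

theorem brPoly_eq_sum [Fintype E] {K : Type*} [Field K] (a b : K) (ha : a ≠ 0) :
    G.brPoly (a + 1) a a⁻¹ b 1 1 =
      ∑ A : Finset E, a ^ ((G.fInt (A : Set E) : ℤ) - G.comps Set.univ) *
        b ^ G.cExt (A : Set E) := by
  refine Finset.sum_congr rfl fun A _ => ?_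
  rw [add_sub_cancel_right, one_pow, one_pow, mul_one, mul_one, inv_zpow', ← zpow_add₀ ha,
    ← zpow_add₀ ha]
  congr 2
  simp only [rank]
  ring

/-! ### Corners of the dual -/

/-- The identification of the corners of a HERG with those of its dual: the corner `(i, j)` of
an edge ribbon is the corner `(j, i)` of the dual ribbon, and the half-ribbons keep their corners. -/
def dualCorner : Equiv.Perm (Corner E H) :=
  Function.Involutive.toPerm
    (fun
      | (inl (e, i), j) => (inl (e, j), i)
      | (inr h, j) => (inr h, j))
    (by rintro ⟨⟨e, i⟩ | h, j⟩ <;> rfl)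

theorem dualCorner_dualCorner (p : Corner E H) : dualCorner (dualCorner p) = p :=
  dualCorner.symm_apply_apply p

theorem dual_arc (p : Corner E H) : G.dual.arc p = dualCorner (G.arc (dualCorner p)) := by
  have h1 : turn (HProperEmbedding.graftCorner (emb p)) = emb (dualCorner p) := by
    obtain ⟨⟨e, i⟩ | h, j⟩ := p <;> rfl
  have h2 (q : Corner E H) :
      HProperEmbedding.unemb (HProperEmbedding.graftCorner (turn (emb q))) = dualCorner q := by
    obtain ⟨⟨e, i⟩ | h, j⟩ := q <;> rfl
  change HProperEmbedding.unemb (HProperEmbedding.graftCorner (turn (G.complArc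
    (turn (HProperEmbedding.graftCorner (emb p)))))) = _
  rw [h1, complArc_emb, h2]

theorem dual_inc (s : Seg E H) :
    G.dual.inc s = Quot.mk _ (inl (emb (dualCorner (s, false)))) := by
  obtain ⟨e, i⟩ | h := s <;> rfl

/-! ### Isolated vertices of the dual -/

/-- The vertex on whose disc an isolated marked point lies.  It is constant along boundary
components, and so singles out the boundary circles of isolated discs. -/
def isolatedVertex (A : Set E) : G.BdComp A → Option V :=
  Quot.lift (Sum.elim (fun _ => none) (fun v => some v.1)) (by rintro _ _ ⟨⟩ <;> rfl)

/-- Each corner of the completed graph lies on a face that carries a segment of the dual. -/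
theorem exists_dual_inc_eq (c : Corner (E ⊕ H) Empty) :
    ∃ s, G.dual.inc s = Quot.mk _ (inl c) := by
  have side (e : E ⊕ H) (i j : Bool) :
      (Quot.mk _ (inl (inl (e, i), j)) : G.completed.BdComp Set.univ) =
        Quot.mk _ (inl (inl (e, !i), j)) :=
    Quot.sound (BdStep.side e (Set.mem_univ _) i j)
  obtain ⟨⟨e | h, i⟩ | h, j⟩ := c
  · refine ⟨inl (e, j), (dual_inc _ _).trans ?_⟩
    cases i
    · rfl
    · exact side (inl e) false j
  · refine ⟨inr h, (dual_inc _ _).trans ?_⟩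
    -- Both sides of the edge `h` lie on one face, which turns around the leaf.
    have turnAround : (Quot.mk _ (inl (inl (inr h, true), false)) : G.completed.BdComp Set.univ) =
        Quot.mk _ (inl (inl (inr h, true), true)) :=
      Quot.sound (BdStep.arc (G := G.completed) (inl (inr h, true), false))
    have h1 := side (inr h) false false
    have h2 := side (inr h) false true
    cases i <;> cases j
    · rfl
    · exact h1.trans (turnAround.trans h2.symm)
    · exact h1
    · exact h1.trans turnAround
  · exact h.elim

theorem completed_inc_ne {v : V} (hv : ∀ s, G.inc s ≠ v) (s : Seg (E ⊕ H) Empty) :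
    G.completed.inc s ≠ inl v := by
  obtain ⟨e | h, _ | _⟩ | h := s
  · exact fun h => hv _ (inl_injective h)
  · exact fun h => hv _ (inl_injective h)
  · exact fun h => hv _ (inl_injective h)
  · exact fun h => inr_ne_inl h
  · exact h.elim

/-- The isolated vertices of the dual are the faces around isolated vertices. -/
noncomputable def isolatedEquiv :
    {v : V // ∀ s, G.inc s ≠ v} ≃ {c // ∀ s, G.dual.inc s ≠ c} :=
  Equiv.ofBijective
    (fun v => ⟨Quot.mk _ (inr ⟨inl v.1, G.completed_inc_ne v.2⟩), fun s hs => by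
      rw [dual_inc] at hs
      exact Option.some_ne_none _ (congrArg (G.completed.isolatedVertex Set.univ) hs).symm⟩)
    (by
      constructor
      · intro v w hvw
        have := congrArg (G.completed.isolatedVertex Set.univ) (congrArg Subtype.val hvw)
        exact Subtype.ext (inl_injective (Option.some_injective _ this))
      · rintro ⟨c, hc⟩
        induction c using Quot.ind with
        | mk x =>
          rcases x with c | ⟨v | h, hv⟩
          · obtain ⟨s, hs⟩ := G.exists_dual_inc_eq c
            exact absurd hs (hc s)
          · refine ⟨⟨v, fun s hs => ?_⟩, rfl⟩
            have := complInc_emb G (s, false)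
            exact hv _ (this.trans (congrArg inl hs))
          · exact absurd rfl (hv (inl (inr h, true))))

/-! ### Boundary components of the dual -/

/-- The identification of the marked points of a HERG with those of its dual. -/
noncomputable def dualPoint : G.BdPoint ≃ G.dual.BdPoint :=
  Equiv.sumCongr dualCorner G.isolatedEquiv

theorem dualPoint_symm_inl (p : Corner E H) :
    G.dualPoint.symm (inl p) = inl (dualCorner p) := rfl

/-- Boundary steps of the subgraph `A` are boundary steps of the subgraph `Aᶜ` of the dual: the
sides of the ribbons in `A` become gaps, and the gaps of the ribbons outside `A` become sides. -/
theorem bdStep_iff_dual (A : Set E) (x y : G.BdPoint) :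
    G.BdStep A x y ↔ G.dual.BdStep Aᶜ (G.dualPoint x) (G.dualPoint y) := by
  constructor
  · rintro (p | ⟨e, he, i, j⟩ | ⟨e, he, i, j⟩ | ⟨h, j⟩)
    · have := BdStep.arc (G := G.dual) (A := Aᶜ) (dualCorner p)
      rwa [dual_arc, dualCorner_dualCorner] at this
    · exact .gap e (Set.notMem_compl_iff.2 he) j i
    · exact .side e he j i
    · exact .halfRibbon h j
  · intro h
    obtain ⟨x, rfl⟩ := G.dualPoint.symm.surjective x
    obtain ⟨y, rfl⟩ := G.dualPoint.symm.surjective y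
    rw [Equiv.apply_symm_apply, Equiv.apply_symm_apply] at h
    obtain p | ⟨e, he, i, j⟩ | ⟨e, he, i, j⟩ | ⟨h, j⟩ := h
    · rw [dual_arc, dualPoint_symm_inl, dualPoint_symm_inl, dualCorner_dualCorner]
      exact .arc _
    · exact .gap e he j i
    · exact .side e (not_not.1 he) j i
    · exact .halfRibbon h j

/-- The boundary components of the subgraph `A` are those of the subgraph `Aᶜ` of the dual. -/
noncomputable def dualComp (A : Set E) : G.BdComp A ≃ G.dual.BdComp Aᶜ :=
  Quot.congr G.dualPoint (G.bdStep_iff_dual A)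

theorem isExternal_dualComp (A : Set E) (c : G.BdComp A) :
    G.dual.IsExternal Aᶜ (G.dualComp A c) ↔ G.IsExternal A c := by
  refine exists_congr fun h => exists_congr fun j => ?_
  exact (G.dualComp A).apply_eq_iff_eq (x := c) (y := Quot.mk _ (inl (inr h, j)))

theorem fInt_dual_compl (A : Set E) : G.dual.fInt Aᶜ = G.fInt A :=
  (Nat.card_congr ((G.dualComp A).subtypeEquiv fun c =>
    not_congr (G.isExternal_dualComp A c).symm)).symm

theorem cExt_dual_compl (A : Set E) : G.dual.cExt Aᶜ = G.cExt A :=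
  (Nat.card_congr ((G.dualComp A).subtypeEquiv fun c => (G.isExternal_dualComp A c).symm)).symm

/-! ### Connected components of the dual -/

/-- One step along a long side or a gluing segment of any ribbon, around a half-ribbon, or along an
arc. -/
def ConnStep (x y : G.BdPoint) : Prop := G.BdStep Set.univ x y ∨ G.BdStep ∅ x y

/-- The vertex disc on which a marked point lies. -/
def vertexOf : G.BdPoint → V := Sum.elim (fun p => G.inc p.1) Subtype.val

theorem vertexOf_surjective : Function.Surjective G.vertexOf := by
  intro v
  by_cases h : ∃ s, G.inc s = v
  · obtain ⟨s, rfl⟩ := h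
    exact ⟨inl (s, false), rfl⟩
  · exact ⟨inr ⟨v, not_exists.1 h⟩, rfl⟩

/-- Marked points on the same disc are connected, since the boundary of a disc is one circle. -/
theorem mk_eq_of_vertexOf_eq {x y : G.BdPoint} (h : G.vertexOf x = G.vertexOf y) :
    Quot.mk G.ConnStep x = Quot.mk G.ConnStep y := by
  rcases x with p | ⟨v, hv⟩ <;> rcases y with q | ⟨w, hw⟩
  · refine Quot.eqvGen_sound (eqvGen_map inl ?_ (G.circle p q h))
    rintro p _ (⟨s, j⟩ | ⟨⟩)
    · obtain ⟨e, i⟩ | h := s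
      · exact .rel _ _ (Or.inr (.gap e (Set.notMem_empty e) i j))
      · exact .rel _ _ (Or.inr (.halfRibbon h j))
    · exact .rel _ _ (Or.inr (.arc _))
  · exact absurd h (hw _)
  · exact absurd h.symm (hv _)
  · obtain rfl : v = w := h
    rfl

theorem comps_univ_eq : G.comps Set.univ = Nat.card (Quot G.ConnStep) := by
  let r (u v : V) : Prop :=
    ∃ e ∈ (Set.univ : Set E), u = G.inc (inl (e, false)) ∧ v = G.inc (inl (e, true))
  have edge (e : E) (i : Bool) :
      Quot.mk r (G.inc (inl (e, i))) = Quot.mk r (G.inc (inl (e, !i))) := by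
    have : Quot.mk r (G.inc (inl (e, false))) = Quot.mk r (G.inc (inl (e, true))) :=
      Quot.sound ⟨e, Set.mem_univ e, rfl, rfl⟩
    cases i
    · exact this
    · exact this.symm
  have step {A : Set E} {x y : G.BdPoint} (h : G.BdStep A x y) :
      Quot.mk r (G.vertexOf x) = Quot.mk r (G.vertexOf y) := by
    obtain p | ⟨e, he, i, j⟩ | ⟨e, he, i, j⟩ | ⟨h, j⟩ := h
    · exact congrArg _ (G.inc_arc p).symm
    · exact edge e i
    · rfl
    · rfl
  let g : V → G.BdPoint := Function.surjInv G.vertexOf_surjective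
  have hg (v : V) : G.vertexOf (g v) = v := Function.surjInv_eq _ v
  refine Nat.card_congr
    { toFun := Quot.lift (fun v => Quot.mk G.ConnStep (g v)) ?_
      invFun := Quot.lift (fun x => Quot.mk r (G.vertexOf x)) fun x y h => h.elim step step
      left_inv := ?_
      right_inv := ?_ }
  · rintro _ _ ⟨e, he, rfl, rfl⟩
    have side : G.ConnStep (inl (inl (e, false), false)) (inl (inl (e, true), false)) :=
      Or.inl (.side e he false false)
    exact (G.mk_eq_of_vertexOf_eq (y := inl (inl (e, false), false)) (hg _)).trans
      ((Quot.sound side).trans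
        (G.mk_eq_of_vertexOf_eq (x := inl (inl (e, true), false)) (hg _).symm))
  · rintro ⟨v⟩
    exact congrArg (Quot.mk r) (hg v)
  · rintro ⟨x⟩
    exact G.mk_eq_of_vertexOf_eq (hg _)

theorem comps_dual_univ : G.dual.comps Set.univ = G.comps Set.univ := by
  rw [comps_univ_eq, comps_univ_eq]
  refine (Nat.card_congr (Quot.congr G.dualPoint fun x y => ?_)).symm
  have h1 := G.bdStep_iff_dual Set.univ x y
  have h2 := G.bdStep_iff_dual ∅ x y
  rw [Set.compl_univ] at h1
  rw [Set.compl_empty] at h2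
  exact (or_congr h1 h2).trans or_comm

end HERG

theorem theorem5p4 {V E H : Type*} [Finite V] [Fintype E] [Finite H] (G : HERG V E H)
    {K : Type*} [Field K] (a b : K) (ha : a ≠ 0) :
    G.brPoly (a + 1) a a⁻¹ b 1 1 = G.dual.brPoly (a + 1) a a⁻¹ b 1 1 := by
  classical
  rw [G.brPoly_eq_sum a b ha, G.dual.brPoly_eq_sum a b ha, G.comps_dual_univ]
  refine Fintype.sum_bijective compl compl_bijective _ _ fun A => ?_
  rw [Finset.coe_compl, G.fInt_dual_compl, G.cExt_dual_compl]
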